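/- Let $d>0$. Let $\ell=\ell(d)>0$ be the unique positive solution of $t^3-t-d=0$, and let $K_m=K_m(d)=\frac{4\ell+3d}{\ell^2}=3\ell+\frac1\ell$ (the minimum of $x+y+\frac1x+\frac1y+\frac d{xy}$ over $x,y>0$). For $K>K_m$ let $f_1<f_2<f_3$ be the three real roots of $2t^3-Kt^2+2t+d=0$ (the coordinates of the diagonal points of the cubic $xy(x+y)+(x+y)+d-Kxy=0$), put $A=K^3-8K-12d$ and $$e_i=2(K+d)\,\frac{f_i}{2f_i-K}+\frac A{12}\quad(i=1,2,3),\qquad g_2=\tfrac1{12}\bigl(K^6-16K^4-24dK^3+16K^2\bigr),$$ so that $e_1>e_2>e_3$ are the roots of the Weierstrass cubic $\Gamma_K:\ Y^2=4X^3-g_2X-g_3$ for a suitable $g_3$. Let $\widetilde V=\bigl(K+d+\frac A{12},\,(K+d)K^{3/2}\bigr)\in\Gamma_K$, let $X(K)$ be the abscissa of the third intersection point of $\Gamma_K$ with its tangent at $\widetilde V$, put $\nu=X(K)-e_1>0$, $\varepsilon=\frac{e_1-e_2}{e_1-e_3}>0$, and define $\theta_d(K)$ by $$2\theta_d(K)=\frac{\displaystyle\int_0^{\sqrt{(e_1-e_3)/\nu}}\frac{du}{\sqrt{(1+u^2)(1+\varepsilon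 u^2)}}}{\displaystyle\int_0^{+\infty}\frac{du}{\sqrt{(1+u^2)(1+\varepsilon u^2)}}}.$$ (This is the rotation number of the map $F(x,y)=(X,Y)$, $Xx=1+\frac dy$, $Yy=1+\frac dX$, restricted to the positive part of the cubic above.) Then: (1) For every $d>0$ the limit $\theta_m(d):=\lim_{K\to K_m,\,K>K_m}\theta_d(K)$ exists and $$\theta_m(d)=\frac1{2\pi}\arccos\Bigl(\frac{1-2\ell^2-\ell^4}{2\ell^4}\Bigr)=\frac1\pi\arccos\Bigl(\frac{\ell^2-1}{2\ell^2}\Bigr).$$ (2) The function $d\mapsto\theta_m(d)$ is continuous and strictly decreasing on $]0,+\infty[$, with limit $\frac12$ as $d\to0^+$ and limit $\frac13$ as $d\to+\infty$. (3) For every $d>0$ the image $\theta_d(]K_m,+\infty[)$ contains the open interval $\bigl]\min(\frac37,\theta_m(d)),\max(\frac37,\theta_m(d))\bigr[$. (4) Let $d_0:=\dfrac{2\sin(\pi/14)}{[1-2\sin(\pi/14)]^{3/2}}$ (one has $|d_0-1.076|<10^{-3}$). For every $d>0$: $\theta_m(d)=\frac37\iff d=d_0$; $\theta_m(d)<\frac37\iff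 d>d_0$; $\theta_m(d)>\frac37\iff d<d_0$. (5) When $d=d_0$, one has $\ell=\ell_0:=\dfrac1{\sqrt{1-2\sin(\pi/14)}}$. -/

import Mathlib

open Set Filter Topology MeasureTheory

noncomputable section

/-- For `d > 0` the equation `t³ - t - d = 0` has exactly one positive solution. -/
theorem existsUnique_ell {d : ℝ} (hd : 0 < d) : ∃! t : ℝ, 0 < t ∧ t ^ 3 - t - d = 0 := by
  have hc : ContinuousOn (fun t : ℝ => t ^ 3 - t - d) (Icc 1 (1 + d)) := by fun_prop
  obtain ⟨t, ht, h0⟩ := intermediate_value_Icc (by linarith) hc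
    (show (0 : ℝ) ∈ Icc _ _ from ⟨by norm_num; linarith, by ring_nf; positivity⟩)
  refine ⟨t, ⟨by linarith [ht.1], h0⟩, ?_⟩
  rintro s ⟨hs, hs0⟩
  simp only at h0
  have ht1 : 1 ≤ t := ht.1
  have hs1 : 1 < s := by
    by_contra h
    nlinarith [mul_nonneg hs.le (mul_nonneg (sub_nonneg.2 (not_lt.1 h)) (by linarith : 0 ≤ s + 1))]
  have hfac : (s - t) * (s ^ 2 + s * t + t ^ 2 - 1) = 0 := by linear_combination hs0 - h0
  rcases mul_eq_zero.1 hfac with h | h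
  · linarith
  · nlinarith

/-- `ℓ`: the positive solution of `t³ - t - d = 0` (meaningful for `d > 0`). -/
def ell (d : ℝ) : ℝ := Classical.epsilon fun t : ℝ => 0 < t ∧ t ^ 3 - t - d = 0

theorem ell_spec {d : ℝ} (hd : 0 < d) : 0 < ell d ∧ ell d ^ 3 - ell d - d = 0 :=
  Classical.epsilon_spec (existsUnique_ell hd).exists

/-- `K_m = (4ℓ + 3d) / ℓ²`, the minimum of `x + y + 1/x + 1/y + d/(xy)` on the open
positive quadrant. -/
def Km (d : ℝ) : ℝ := (4 * ell d + 3 * d) / ell d ^ 2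

/-- For `K > K_m` the cubic `xy(x+y) + (x+y) + d - Kxy = 0` has exactly three points on the
diagonal: their abscissas are the three real roots of `2t³ - Kt² + 2t + d`. -/
theorem existsUnique_diagRoots {d K : ℝ} (hd : 0 < d) (hK : Km d < K) :
    ∃! f : Fin 3 → ℝ, StrictMono f ∧ ∀ i, 2 * f i ^ 3 - K * f i ^ 2 + 2 * f i + d = 0 := by
  obtain ⟨hl, hl0⟩ := ell_spec hd
  set l := ell d
  have hKl : 4 * l + 3 * d < K * l ^ 2 := by
    rwa [Km, div_lt_iff₀ (by positivity)] at hK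
  have hK0 : 0 < K := by
    by_contra h
    nlinarith [mul_nonneg (neg_nonneg.2 (not_lt.1 h)) (sq_nonneg l)]
  set p : ℝ → ℝ := fun t => 2 * t ^ 3 - K * t ^ 2 + 2 * t + d with hp
  have hcont : ∀ s, ContinuousOn p s := fun s => by fun_prop
  have hpl : p l < 0 := by simp only [hp]; nlinarith
  have hp0 : 0 < p 0 := by simp only [hp]; linarith
  have hpm : p (-d) < 0 := by
    simp only [hp]
    have h1 : 0 < d ^ 3 := by positivity
    have h2 : 0 < K * d ^ 2 := by positivity
    nlinarith
  have hpK : 0 < p (l + K) := by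
    simp only [hp]
    have e : 2 * (l + K) ^ 3 - K * (l + K) ^ 2 + 2 * (l + K) + d
      = (l + K) ^ 2 * (2 * l + K) + 2 * (l + K) + d := by ring
    rw [e]; positivity
  obtain ⟨a, ha, ha0⟩ := intermediate_value_Ioo (by linarith : -d ≤ 0) (hcont _)
    (show (0 : ℝ) ∈ Ioo _ _ from ⟨hpm, hp0⟩)
  obtain ⟨b, hb, hb0⟩ := intermediate_value_Ioo' hl.le (hcont _)
    (show (0 : ℝ) ∈ Ioo _ _ from ⟨hpl, hp0⟩)
  obtain ⟨c, hc, hc0⟩ := intermediate_value_Ioo (by linarith : l ≤ l + K) (hcont _)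
    (show (0 : ℝ) ∈ Ioo _ _ from ⟨hpl, hpK⟩)
  simp only [hp] at ha0 hb0 hc0
  have hab : a < b := ha.2.trans hb.1
  have hbc : b < c := hb.2.trans hc.1
  have q1 : 2 * (a ^ 2 + a * b + b ^ 2) - K * (a + b) + 2 = 0 := by
    have : (a - b) * (2 * (a ^ 2 + a * b + b ^ 2) - K * (a + b) + 2) = 0 := by
      linear_combination ha0 - hb0
    rcases mul_eq_zero.1 this with h | h
    · linarith
    · exact h
  have q2 : 2 * (b ^ 2 + b * c + c ^ 2) - K * (b + c) + 2 = 0 := by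
    have : (b - c) * (2 * (b ^ 2 + b * c + c ^ 2) - K * (b + c) + 2) = 0 := by
      linear_combination hb0 - hc0
    rcases mul_eq_zero.1 this with h | h
    · linarith
    · exact h
  have q3 : 2 * (a + b + c) = K := by
    have : (a - c) * (2 * (a + b + c) - K) = 0 := by linear_combination q1 - q2
    rcases mul_eq_zero.1 this with h | h
    · linarith
    · linarith
  have roots : ∀ t : ℝ, 2 * t ^ 3 - K * t ^ 2 + 2 * t + d = 0 → t = a ∨ t = b ∨ t = c := by
    intro t ht
    have : (t - a) * ((t - b) * (t - c)) = 0 := by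
      have e2 : a * b + b * c + c * a = 1 := by
        linear_combination (-1 / 2) * q1 + (a + b) / 2 * q3
      have e3 : 2 * (a * b * c) = -d := by
        linear_combination ha0 - a ^ 2 * q3 + 2 * a * e2
      linear_combination (1 / 2) * ht - t ^ 2 / 2 * q3 + t * e2 - (1 / 2) * e3
    rcases mul_eq_zero.1 this with h | h
    · left; linarith
    · rcases mul_eq_zero.1 h with h | h
      · right; left; linarith
      · right; right; linarith
  refine ⟨![a, b, c], ⟨?_, ?_⟩, ?_⟩
  · rw [Fin.strictMono_iff_lt_succ]
    intro i
    fin_cases i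
    · exact hab
    · exact hbc
  · intro i
    fin_cases i
    · exact ha0
    · exact hb0
    · exact hc0
  · rintro f ⟨hm, hf⟩
    have h01 : f 0 < f 1 := hm (by decide)
    have h12 : f 1 < f 2 := hm (by decide)
    have key : f 0 = a ∧ f 1 = b ∧ f 2 = c := by
      rcases roots _ (hf 0) with h0 | h0 | h0 <;> rcases roots _ (hf 1) with h1 | h1 | h1 <;>
        rcases roots _ (hf 2) with h2 | h2 | h2 <;> first
          | exact ⟨h0, h1, h2⟩
          | (exfalso; linarith)
    funext i
    fin_cases i
    · exact key.1
    · exact key.2.1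
    · exact key.2.2

/-- `f₁ < f₂ < f₃` (indexed by `0, 1, 2`): the coordinates of the three diagonal points of the
cubic `xy(x+y) + (x+y) + d - Kxy = 0` (meaningful for `d > 0`, `K > K_m`). -/
def diagRoots (d K : ℝ) : Fin 3 → ℝ := Classical.epsilon fun f : Fin 3 → ℝ =>
  StrictMono f ∧ ∀ i, 2 * f i ^ 3 - K * f i ^ 2 + 2 * f i + d = 0

theorem diagRoots_spec {d K : ℝ} (hd : 0 < d) (hK : Km d < K) :
    StrictMono (diagRoots d K) ∧ ∀ i, 2 * diagRoots d K i ^ 3 - K * diagRoots d K i ^ 2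
      + 2 * diagRoots d K i + d = 0 :=
  Classical.epsilon_spec (existsUnique_diagRoots hd hK).exists

/-- `A = K³ - 8K - 12d`. -/
def coefA (d K : ℝ) : ℝ := K ^ 3 - 8 * K - 12 * d

/-- `λ = K^{-3/2}`. -/
def lam (K : ℝ) : ℝ := 1 / K ^ (3 / 2 : ℝ)

/-- `μ = 2 (K + d) / K^{3/2}`. -/
def mu (d K : ℝ) : ℝ := 2 * (K + d) / K ^ (3 / 2 : ℝ)

/-- `e₁ > e₂ > e₃` (indexed by `0, 1, 2`): the abscissas of the images of the diagonal points in
the Weierstrass cubic `Γ_K : Y² = 4X³ - g₂X - g₃`. -/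
def eRoot (d K : ℝ) (i : Fin 3) : ℝ :=
  mu d K / lam K * (diagRoots d K i / (2 * diagRoots d K i - K)) + coefA d K / 12

/-- The coefficient `g₂` of `Γ_K`. -/
def g2 (d K : ℝ) : ℝ := (K ^ 6 - 16 * K ^ 4 - 24 * d * K ^ 3 + 16 * K ^ 2) / 12

/-- The abscissa of the point `Ṽ` of `Γ_K`, image of the vertical point at infinity `V`. -/
def xV (d K : ℝ) : ℝ := K + d + coefA d K / 12

/-- The ordinate of the point `Ṽ` of `Γ_K`. -/
def yV (d K : ℝ) : ℝ := (K + d) * K ^ (3 / 2 : ℝ)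

/-- `X(K)`: the abscissa of `Ṽ * Ṽ = (H̃ * ω) * Ṽ`, the point where the tangent at `Ṽ` to
`Y² = 4X³ - g₂X - g₃` meets the cubic again. The tangent has slope `p = (12 xV² - g₂) / (2 yV)`
and the three abscissas of intersection have sum `p² / 4`. -/
def bigX (d K : ℝ) : ℝ :=
  ((12 * xV d K ^ 2 - g2 d K) / (2 * yV d K)) ^ 2 / 4 - 2 * xV d K

/-- `ν = X(K) - e₁`. -/
def nu (d K : ℝ) : ℝ := bigX d K - eRoot d K 0

/-- `ε = (e₁ - e₂) / (e₁ - e₃)`. -/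
def eps (d K : ℝ) : ℝ := (eRoot d K 0 - eRoot d K 1) / (eRoot d K 0 - eRoot d K 2)

/-- The number `θ_d(K)`, defined for `d > 0` and `K > K_m`:
`2 θ_d(K) = ∫_0^{√((e₁-e₃)/ν)} du / √((1+u²)(1+εu²)) / ∫_0^∞ du / √((1+u²)(1+εu²))`. -/
def theta (d K : ℝ) : ℝ :=
  (1 / 2) *
    ((∫ u in (0 : ℝ)..√((eRoot d K 0 - eRoot d K 2) / nu d K),
        1 / √((1 + u ^ 2) * (1 + eps d K * u ^ 2))) /
      ∫ u in Ioi (0 : ℝ), 1 / √((1 + u ^ 2) * (1 + eps d K * u ^ 2)))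

/-- `θ_m(d)`: the limit of `θ_d(K)` when `K → K_m`, `K > K_m` (its existence is part of the
theorem). -/
def thetaM (d : ℝ) : ℝ := limUnder (𝓝[>] Km d) (theta d)

/-- `d₀ = 2 sin(π/14) / (1 - 2 sin(π/14))^{3/2}`. -/
def d0 : ℝ := 2 * Real.sin (Real.pi / 14) / (1 - 2 * Real.sin (Real.pi / 14)) ^ (3 / 2 : ℝ)

end

open Asymptotics

/-! Everything is expressed through the roots f₁ < f₂ < f₃ of p(t) = 2t³ - Kt² + 2t + d. The tangent
at Ṽ has slope exactly K^{3/2}, which gives X(K) = (K³ - 8K)/12. With Vieta and p(K/2) = K + d, both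
L = (e₁ - e₃)/ν and ε become rational functions of K, d and the fᵢ (`eRoot_sub_div_nu`, `eps_eq`).
Then θ_d(K) is a continuous function of (L, ε) for ε > 0 (`tendsto_theta`), and the behaviour of the
roots decides everything.

As K → K_m the roots f₂ and f₃ merge at ℓ. Hence ε → 1, both integrands become 1/(1 + u²), and
θ_d(K) tends to (1/π) arctan √L at the limiting L, which is the arccosine of the statement
(`tendsto_theta_Km`).

As K → ∞, f₁ and f₂ behave like ∓√(d/K) and K - 2f₃ like 4/K, so ε ~ 16√d K^{-7/2} and L ~ K³/(4d).
Up to O(1) the complete integral is log(1/√ε) = (7/4) log K and the incomplete one is log √L = (3/2)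
log K. So θ_d(K) → (1/2)(3/2)/(7/4) = 3/7 (`tendsto_theta_atTop`). The intermediate value theorem
then gives the image.

The claims about θ_m reduce to ℓ(d) being a continuous increasing bijection from ]0,∞[ to ]1,∞[,
since θ_m = (1/π) arccos((1 - ℓ⁻²)/2). The value 3/7 means (1 - ℓ⁻²)/2 = cos(3π/7) = sin(π/14),
which determines ℓ₀ and d₀ = ℓ₀³ - ℓ₀. -/

/-! ### The number ℓ and the cubic at K = K_m -/

theorem one_lt_ell {d : ℝ} (hd : 0 < d) : 1 < ell d := by
  obtain ⟨hl, h0⟩ := ell_spec hd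
  by_contra h
  nlinarith [mul_nonneg hl.le (mul_nonneg (sub_nonneg.2 (not_lt.1 h))
    (by linarith : 0 ≤ ell d + 1))]

theorem Km_eq {d : ℝ} (hd : 0 < d) : Km d = 3 * ell d + 1 / ell d := by
  have hl := one_lt_ell hd
  have h0 := (ell_spec hd).2
  have hne : ell d ≠ 0 := by linarith
  have : 3 * d = 3 * ell d ^ 3 - 3 * ell d := by linarith
  rw [Km, this]
  field_simp
  ring

theorem Km_pos {d : ℝ} (hd : 0 < d) : 0 < Km d := by
  have hl := one_lt_ell hd
  rw [Km_eq hd]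
  positivity

/-- The cubic polynomial whose roots are the abscissas of the diagonal points. -/
noncomputable def diagPoly (d K t : ℝ) : ℝ := 2 * t ^ 3 - K * t ^ 2 + 2 * t + d

/-- At the critical value K_m the point ℓ is a double root; this is the source of the merging of f₂
and f₃. -/
theorem diagPoly_Km {d : ℝ} (hd : 0 < d) (t : ℝ) :
    diagPoly d (Km d) t = (t - ell d) ^ 2 * (2 * t + d / ell d ^ 2) := by
  have hl := one_lt_ell hd
  have h0 := (ell_spec hd).2
  have hne : ell d ≠ 0 := by linarith
  rw [Km_eq hd, diagPoly]
  have h1 : d / ell d ^ 2 = ell d - 1 / ell d := by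
    field_simp
    linarith
  have h2 : d = ell d ^ 2 * (ell d - 1 / ell d) := by
    field_simp
    linarith
  rw [h1]
  -- The first two occurrences of `d` sit inside `ell d`; the third is the constant term of the
  -- cubic.
  nth_rw 3 [h2]
  field_simp
  ring

/-! ### Position of the diagonal roots -/

section Roots

variable {d K : ℝ}

theorem diagRoots_lt (hd : 0 < d) (hK : Km d < K) :
    diagRoots d K 0 < diagRoots d K 1 ∧ diagRoots d K 1 < diagRoots d K 2 :=
  ⟨(diagRoots_spec hd hK).1 (by decide), (diagRoots_spec hd hK).1 (by decide)⟩

theorem diagRoots_vieta (hd : 0 < d) (hK : Km d < K) :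
    2 * (diagRoots d K 0 + diagRoots d K 1 + diagRoots d K 2) = K ∧
    diagRoots d K 0 * diagRoots d K 1 + diagRoots d K 1 * diagRoots d K 2
      + diagRoots d K 2 * diagRoots d K 0 = 1 ∧
    2 * (diagRoots d K 0 * diagRoots d K 1 * diagRoots d K 2) = -d := by
  obtain ⟨hab, hbc⟩ := diagRoots_lt hd hK
  have ha0 := (diagRoots_spec hd hK).2 0
  have hb0 := (diagRoots_spec hd hK).2 1
  have hc0 := (diagRoots_spec hd hK).2 2
  set a := diagRoots d K 0
  set b := diagRoots d K 1
  set c := diagRoots d K 2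
  have q1 : 2 * (a ^ 2 + a * b + b ^ 2) - K * (a + b) + 2 = 0 :=
    mul_left_cancel₀ (sub_ne_zero.2 hab.ne) (by linear_combination ha0 - hb0)
  have q2 : 2 * (b ^ 2 + b * c + c ^ 2) - K * (b + c) + 2 = 0 :=
    mul_left_cancel₀ (sub_ne_zero.2 hbc.ne) (by linear_combination hb0 - hc0)
  have q3 : 2 * (a + b + c) = K :=
    mul_left_cancel₀ (sub_ne_zero.2 (hab.trans hbc).ne) (by linear_combination q1 - q2)
  have e2 : a * b + b * c + c * a = 1 := by
    linear_combination (-1 / 2) * q1 + (a + b) / 2 * q3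
  exact ⟨q3, e2, by linear_combination ha0 - a ^ 2 * q3 + 2 * a * e2⟩

theorem diagPoly_eq_mul (hd : 0 < d) (hK : Km d < K) (t : ℝ) :
    diagPoly d K t =
      2 * ((t - diagRoots d K 0) * ((t - diagRoots d K 1) * (t - diagRoots d K 2))) := by
  obtain ⟨h1, h2, h3⟩ := diagRoots_vieta hd hK
  rw [diagPoly]
  linear_combination t ^ 2 * h1 - 2 * t * h2 + h3

/-- The double root at K_m turns into a negative value for K > K_m, because p decreases with K. So ℓ
separates f₂ from f₃ for all K > K_m. -/
theorem diagPoly_ell_neg (hd : 0 < d) (hK : Km d < K) : diagPoly d K (ell d) < 0 := by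
  have hl := one_lt_ell hd
  have h := diagPoly_Km hd (ell d)
  simp only [diagPoly, sub_self] at h ⊢
  have : Km d * ell d ^ 2 < K * ell d ^ 2 := by gcongr
  nlinarith

theorem diagRoots_sign (hd : 0 < d) (hK : Km d < K) :
    diagRoots d K 0 < 0 ∧ 0 < diagRoots d K 1 := by
  obtain ⟨hab, hbc⟩ := diagRoots_lt hd hK
  obtain ⟨h1, h2, h3⟩ := diagRoots_vieta hd hK
  have hK0 := (Km_pos hd).trans hK
  have hc : 0 < diagRoots d K 2 := by linarith
  have hneg : diagRoots d K 0 * diagRoots d K 1 < 0 := by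
    by_contra h
    have := mul_nonneg (not_lt.1 h) hc.le
    linarith
  rcases mul_neg_iff.1 hneg with h | h
  · linarith
  · exact h

theorem diagRoots_ell (hd : 0 < d) (hK : Km d < K) :
    diagRoots d K 1 < ell d ∧ ell d < diagRoots d K 2 := by
  obtain ⟨hab, hbc⟩ := diagRoots_lt hd hK
  obtain ⟨ha, hb⟩ := diagRoots_sign hd hK
  have hl := one_lt_ell hd
  have h := diagPoly_ell_neg hd hK
  rw [diagPoly_eq_mul hd hK] at h
  have hneg : (ell d - diagRoots d K 1) * (ell d - diagRoots d K 2) < 0 :=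
    neg_of_mul_neg_right (by linarith : (ell d - diagRoots d K 0) * _ < 0) (by linarith)
  rcases mul_neg_iff.1 hneg with h | h
  · exact ⟨by linarith, by linarith⟩
  · linarith

/-- The cubic is negative at -d/2, which therefore lies to the left of f₁. This makes ν positive. -/
theorem neg_half_lt_diagRoots (hd : 0 < d) (hK : Km d < K) : 0 < d + 2 * diagRoots d K 0 := by
  obtain ⟨hab, hbc⟩ := diagRoots_lt hd hK
  obtain ⟨ha, hb⟩ := diagRoots_sign hd hK
  have hK0 := (Km_pos hd).trans hK
  have h := diagPoly_eq_mul hd hK (-d / 2)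
  have hn : diagPoly d K (-d / 2) < 0 := by
    have : diagPoly d K (-d / 2) = -(d ^ 3 / 4 + K * d ^ 2 / 4) := by
      rw [diagPoly]; ring
    rw [this]
    have : 0 < d ^ 3 / 4 + K * d ^ 2 / 4 := by positivity
    linarith
  by_contra hc
  have : 0 ≤ (-d / 2 - diagRoots d K 0) * ((-d / 2 - diagRoots d K 1) *
      (-d / 2 - diagRoots d K 2)) :=
    mul_nonneg (by linarith) (mul_nonneg_of_nonpos_of_nonpos (by linarith) (by linarith))
  linarith

/-- By Vieta, K - 2f₃ = 2(f₁ + f₂) and f₃(f₁ + f₂) = 1 - f₁f₂ > 0. This makes ε positive. -/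
theorem two_mul_diagRoots_lt (hd : 0 < d) (hK : Km d < K) : 0 < K - 2 * diagRoots d K 2 := by
  obtain ⟨hab, hbc⟩ := diagRoots_lt hd hK
  obtain ⟨ha, hb⟩ := diagRoots_sign hd hK
  have hK0 := (Km_pos hd).trans hK
  obtain ⟨h1, h2, h3⟩ := diagRoots_vieta hd hK
  have hc : 0 < diagRoots d K 2 := by linarith
  have : 0 < diagRoots d K 2 * (diagRoots d K 0 + diagRoots d K 1) := by
    nlinarith [mul_neg_of_neg_of_pos ha hb]
  have := pos_of_mul_pos_right this hc.le
  linarith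

/-- The factorisation of p evaluated at K/2, where p(K/2) = K + d. -/
theorem prod_sub_diagRoots (hd : 0 < d) (hK : Km d < K) :
    (K - 2 * diagRoots d K 0) * ((K - 2 * diagRoots d K 1) * (K - 2 * diagRoots d K 2))
      = 4 * (K + d) := by
  have h := diagPoly_eq_mul hd hK (K / 2)
  rw [diagPoly] at h
  linear_combination -4 * h

/-- To the right of ℓ the factors of f₁ and f₂ are positive, so the sign of p(a) alone locates f₃.
Fixing a and letting K vary turns limits of f₃ into limits of p(a), with no formula for the roots.
-/
theorem lt_diagRoots_two_iff (hd : 0 < d) (hK : Km d < K) {a : ℝ} (ha : ell d ≤ a) :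
    (a < diagRoots d K 2 ↔ diagPoly d K a < 0) ∧ (diagRoots d K 2 < a ↔ 0 < diagPoly d K a) := by
  obtain ⟨hab, hbc⟩ := diagRoots_lt hd hK
  obtain ⟨hl1, hl2⟩ := diagRoots_ell hd hK
  have hp : 0 < 2 * ((a - diagRoots d K 0) * (a - diagRoots d K 1)) :=
    mul_pos two_pos (mul_pos (by linarith) (by linarith))
  have e : diagPoly d K a = 2 * ((a - diagRoots d K 0) * (a - diagRoots d K 1)) *
      (a - diagRoots d K 2) := by rw [diagPoly_eq_mul hd hK]; ring
  rw [e, ← neg_pos, ← mul_neg, mul_pos_iff_of_pos_left hp, mul_pos_iff_of_pos_left hp]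
  simp

theorem lt_diagRoots_one_iff (hd : 0 < d) (hK : Km d < K) {a : ℝ} (h0 : 0 < a) (ha : a ≤ ell d) :
    (a < diagRoots d K 1 ↔ 0 < diagPoly d K a) ∧ (diagRoots d K 1 < a ↔ diagPoly d K a < 0) := by
  obtain ⟨hab, hbc⟩ := diagRoots_lt hd hK
  obtain ⟨hl1, hl2⟩ := diagRoots_ell hd hK
  obtain ⟨hs1, hs2⟩ := diagRoots_sign hd hK
  have hp : 0 < 2 * ((a - diagRoots d K 0) * (diagRoots d K 2 - a)) :=
    mul_pos two_pos (mul_pos (by linarith) (by linarith))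
  have e : diagPoly d K a = 2 * ((a - diagRoots d K 0) * (diagRoots d K 2 - a)) *
      (diagRoots d K 1 - a) := by rw [diagPoly_eq_mul hd hK]; ring
  rw [e, ← neg_pos (a := _ * (_ - a)), ← mul_neg, mul_pos_iff_of_pos_left hp,
    mul_pos_iff_of_pos_left hp]
  simp

end Roots

/-! ### Limits of the roots in K -/

theorem tendsto_diagPoly (d K₀ a : ℝ) (s : Set ℝ) :
    Tendsto (fun K => diagPoly d K a) (𝓝[s] K₀) (𝓝 (diagPoly d K₀ a)) := by
  have : Continuous fun K => diagPoly d K a := by unfold diagPoly; fun_prop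
  exact this.continuousAt.tendsto.mono_left nhdsWithin_le_nhds

/-- The base point K₀ is left free so that the same lemma gives continuity at K₀ > K_m and the limit
at K₀ = K_m. -/
theorem tendsto_diagRoots_two {d K₀ x : ℝ} (hd : 0 < d) (hx : ell d ≤ x)
    (h1 : ∀ a, ell d ≤ a → a < x → diagPoly d K₀ a < 0)
    (h2 : ∀ a, x < a → 0 < diagPoly d K₀ a) :
    Tendsto (fun K => diagRoots d K 2) (𝓝[Ioi (Km d)] K₀) (𝓝 x) := by
  refine tendsto_order.2 ⟨fun a ha => ?_, fun a ha => ?_⟩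
  · by_cases hla : ell d ≤ a
    · filter_upwards [self_mem_nhdsWithin,
        (tendsto_diagPoly d K₀ a (Ioi (Km d))).eventually_lt_const (h1 a hla ha)] with K hK hp
      exact (lt_diagRoots_two_iff hd hK hla).1.2 hp
    · filter_upwards [self_mem_nhdsWithin] with K hK
      exact (not_le.1 hla).trans (diagRoots_ell hd hK).2
  · filter_upwards [self_mem_nhdsWithin,
      (tendsto_diagPoly d K₀ a (Ioi (Km d))).eventually_const_lt (h2 a ha)] with K hK hp
    exact (lt_diagRoots_two_iff hd hK (hx.trans ha.le)).2.2 hp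

theorem tendsto_diagRoots_one {d K₀ x : ℝ} (hd : 0 < d) (hx0 : 0 < x) (hx : x ≤ ell d)
    (h1 : ∀ a, 0 < a → a < x → 0 < diagPoly d K₀ a)
    (h2 : ∀ a, x < a → a ≤ ell d → diagPoly d K₀ a < 0) :
    Tendsto (fun K => diagRoots d K 1) (𝓝[Ioi (Km d)] K₀) (𝓝 x) := by
  refine tendsto_order.2 ⟨fun a ha => ?_, fun a ha => ?_⟩
  · by_cases h0 : 0 < a
    · filter_upwards [self_mem_nhdsWithin,
        (tendsto_diagPoly d K₀ a (Ioi (Km d))).eventually_const_lt (h1 a h0 ha)] with K hK hp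
      exact (lt_diagRoots_one_iff hd hK h0 (ha.le.trans hx)).1.2 hp
    · filter_upwards [self_mem_nhdsWithin] with K hK
      exact (not_lt.1 h0).trans_lt (diagRoots_sign hd hK).2
  · by_cases hla : a ≤ ell d
    · filter_upwards [self_mem_nhdsWithin,
        (tendsto_diagPoly d K₀ a (Ioi (Km d))).eventually_lt_const (h2 a ha hla)] with K hK hp
      exact (lt_diagRoots_one_iff hd hK (hx0.trans ha) hla).2.2 hp
    · filter_upwards [self_mem_nhdsWithin] with K hK
      exact (diagRoots_ell hd hK).1.trans (not_le.1 hla)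

theorem tendsto_diagRoots_zero {d K₀ x y : ℝ} (hd : 0 < d)
    (h1 : Tendsto (fun K => diagRoots d K 1) (𝓝[Ioi (Km d)] K₀) (𝓝 x))
    (h2 : Tendsto (fun K => diagRoots d K 2) (𝓝[Ioi (Km d)] K₀) (𝓝 y)) :
    Tendsto (fun K => diagRoots d K 0) (𝓝[Ioi (Km d)] K₀) (𝓝 (K₀ / 2 - x - y)) := by
  have hK : Tendsto (fun K : ℝ => K) (𝓝[Ioi (Km d)] K₀) (𝓝 K₀) := nhdsWithin_le_nhds
  refine (((hK.div_const 2).sub h1).sub h2).congr' ?_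
  filter_upwards [self_mem_nhdsWithin] with K hK
  linarith [(diagRoots_vieta hd hK).1]

theorem continuousWithinAt_diagRoots {d K₀ : ℝ} (hd : 0 < d) (hK₀ : Km d < K₀) (i : Fin 3) :
    Tendsto (fun K => diagRoots d K i) (𝓝[Ioi (Km d)] K₀) (𝓝 (diagRoots d K₀ i)) := by
  obtain ⟨hl1, hl2⟩ := diagRoots_ell hd hK₀
  have t1 := tendsto_diagRoots_one hd (diagRoots_sign hd hK₀).2 hl1.le
    (fun a h0 ha => (lt_diagRoots_one_iff hd hK₀ h0 (ha.trans hl1).le).1.1 ha)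
    (fun a ha hla => (lt_diagRoots_one_iff hd hK₀
      ((diagRoots_sign hd hK₀).2.trans ha) hla).2.1 ha)
  have t2 := tendsto_diagRoots_two hd hl2.le
    (fun a hla ha => (lt_diagRoots_two_iff hd hK₀ hla).1.1 ha)
    (fun a ha => (lt_diagRoots_two_iff hd hK₀ (hl2.trans ha).le).2.1 ha)
  fin_cases i
  · have := tendsto_diagRoots_zero hd t1 t2
    rwa [show K₀ / 2 - diagRoots d K₀ 1 - diagRoots d K₀ 2 = diagRoots d K₀ 0 by
      linarith [(diagRoots_vieta hd hK₀).1]] at this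
  · exact t1
  · exact t2

theorem diagPoly_Km_pos {d a : ℝ} (hd : 0 < d) (ha : 0 < a) (hne : a ≠ ell d) :
    0 < diagPoly d (Km d) a := by
  have hl := one_lt_ell hd
  rw [diagPoly_Km hd]
  have : 0 < (a - ell d) ^ 2 := by
    have := sub_ne_zero.2 hne
    positivity
  positivity

theorem tendsto_diagRoots_Km {d : ℝ} (hd : 0 < d) :
    Tendsto (fun K => diagRoots d K 0) (𝓝[>] Km d) (𝓝 (-(ell d - 1 / ell d) / 2)) ∧
    Tendsto (fun K => diagRoots d K 1) (𝓝[>] Km d) (𝓝 (ell d)) ∧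
    Tendsto (fun K => diagRoots d K 2) (𝓝[>] Km d) (𝓝 (ell d)) := by
  have hl := one_lt_ell hd
  have t1 := tendsto_diagRoots_one (K₀ := Km d) hd (by linarith) le_rfl
    (fun a h0 ha => diagPoly_Km_pos hd h0 ha.ne) (fun a ha hla => absurd ha hla.not_gt)
  have t2 := tendsto_diagRoots_two (K₀ := Km d) hd le_rfl
    (fun a hla ha => absurd ha hla.not_gt)
    (fun a ha => diagPoly_Km_pos hd (by linarith) ha.ne')
  refine ⟨?_, t1, t2⟩
  convert tendsto_diagRoots_zero hd t1 t2 using 2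
  rw [Km_eq hd]
  ring

/-! ### The Weierstrass data as rational functions of the roots -/

section Weierstrass

variable {d K : ℝ}

theorem mu_div_lam (hK : 0 < K) : mu d K / lam K = 2 * (K + d) := by
  have : K ^ (3 / 2 : ℝ) ≠ 0 := (Real.rpow_pos_of_pos hK _).ne'
  rw [mu, lam]
  field_simp

/-- The numerator 12 x² - g₂ of the tangent slope collapses to 2K³(K + d), so the slope is K^{3/2}
and its square is K³. -/
theorem bigX_eq (hd : 0 < d) (hK : 0 < K) : bigX d K = (K ^ 3 - 8 * K) / 12 := by
  have hsq : (K ^ (3 / 2 : ℝ)) ^ 2 = K ^ 3 := by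
    rw [← Real.rpow_natCast, ← Real.rpow_mul hK.le, ← Real.rpow_natCast]
    norm_num
  have hp : K ^ (3 / 2 : ℝ) ≠ 0 := (Real.rpow_pos_of_pos hK _).ne'
  have h : 12 * xV d K ^ 2 - g2 d K = 2 * K ^ 3 * (K + d) := by
    rw [xV, g2, coefA]; ring
  have hKd : K + d ≠ 0 := by positivity
  have h' : 2 * K ^ 3 * (K + d) / (2 * yV d K) = K ^ (3 / 2 : ℝ) := by
    rw [yV, ← hsq]
    field_simp
  rw [bigX, h, h', hsq, xV, coefA]
  ring

theorem nu_eq (hd : 0 < d) (hK : Km d < K) :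
    nu d K = K * (d + 2 * diagRoots d K 0) / (K - 2 * diagRoots d K 0) := by
  have hK0 := (Km_pos hd).trans hK
  have h0 := (diagRoots_sign hd hK).1
  have h1 : K - 2 * diagRoots d K 0 ≠ 0 := by linarith
  have h2 : 2 * diagRoots d K 0 - K ≠ 0 := by linarith
  rw [nu, bigX_eq hd hK0, eRoot, mu_div_lam hK0, coefA]
  field_simp
  ring

theorem eRoot_sub (hd : 0 < d) (hK : Km d < K) {i j : Fin 3} :
    eRoot d K i - eRoot d K j = 2 * (K + d) * K * (diagRoots d K j - diagRoots d K i) /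
      ((K - 2 * diagRoots d K i) * (K - 2 * diagRoots d K j)) := by
  have hK0 := (Km_pos hd).trans hK
  have hi : ∀ i, 0 < K - 2 * diagRoots d K i := by
    intro i
    have := (diagRoots_spec hd hK).1.monotone (Fin.le_last i)
    have h2 := two_mul_diagRoots_lt hd hK
    change diagRoots d K i ≤ diagRoots d K 2 at this
    linarith
  have h1 := (hi i).ne'
  have h2 := (hi j).ne'
  have h3 : 2 * diagRoots d K i - K ≠ 0 := by linarith [hi i]
  have h4 : 2 * diagRoots d K j - K ≠ 0 := by linarith [hi j]
  rw [eRoot, eRoot, mu_div_lam hK0]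
  field_simp
  ring

theorem eRoot_sub_div_nu (hd : 0 < d) (hK : Km d < K) :
    (eRoot d K 0 - eRoot d K 2) / nu d K =
      (K - 2 * diagRoots d K 0) * (K - 2 * diagRoots d K 1) *
        (diagRoots d K 2 - diagRoots d K 0) / (2 * (d + 2 * diagRoots d K 0)) := by
  have hK0 := (Km_pos hd).trans hK
  have h0 := diagRoots_lt hd hK
  have h2 := two_mul_diagRoots_lt hd hK
  have h3 := neg_half_lt_diagRoots hd hK
  have n0 : K - 2 * diagRoots d K 0 ≠ 0 := by linarith
  have n1 : K - 2 * diagRoots d K 1 ≠ 0 := by linarith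
  have e := prod_sub_diagRoots hd hK
  -- Replacing K + d by the product of the K - 2fᵢ lets the factor K - 2f₃ of the denominator
  -- cancel.
  have e' : 2 * (K + d) = (K - 2 * diagRoots d K 0) * ((K - 2 * diagRoots d K 1) *
    (K - 2 * diagRoots d K 2)) / 2 := by linarith
  rw [eRoot_sub hd hK, nu_eq hd hK, e']
  field_simp

theorem eps_eq (hd : 0 < d) (hK : Km d < K) :
    eps d K = (diagRoots d K 1 - diagRoots d K 0) * (K - 2 * diagRoots d K 2) /
      ((diagRoots d K 2 - diagRoots d K 0) * (K - 2 * diagRoots d K 1)) := by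
  have hK0 := (Km_pos hd).trans hK
  have h0 := diagRoots_lt hd hK
  have h2 := two_mul_diagRoots_lt hd hK
  have n0 : K - 2 * diagRoots d K 0 ≠ 0 := by linarith
  have n1 : K - 2 * diagRoots d K 1 ≠ 0 := by linarith
  have n3 : diagRoots d K 2 - diagRoots d K 0 ≠ 0 := by linarith
  have n4 : K + d ≠ 0 := by positivity
  rw [eps, eRoot_sub hd hK, eRoot_sub hd hK]
  field_simp

theorem eps_pos (hd : 0 < d) (hK : Km d < K) : 0 < eps d K := by
  have h0 := diagRoots_lt hd hK
  have h2 := two_mul_diagRoots_lt hd hK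
  rw [eps_eq hd hK]
  exact div_pos (mul_pos (by linarith) h2) (mul_pos (by linarith) (by linarith))

theorem eRoot_sub_div_nu_pos (hd : 0 < d) (hK : Km d < K) :
    0 < (eRoot d K 0 - eRoot d K 2) / nu d K := by
  have h0 := diagRoots_lt hd hK
  have h2 := two_mul_diagRoots_lt hd hK
  rw [eRoot_sub_div_nu hd hK]
  exact div_pos (mul_pos (mul_pos (by linarith) (by linarith)) (by linarith))
    (mul_pos two_pos (neg_half_lt_diagRoots hd hK))

end Weierstrass

/-! ### Elliptic integrals: continuity and logarithmic bounds -/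

/-- The integrand of the elliptic integrals that define the rotation number. -/
noncomputable def ellIntegrand (e u : ℝ) : ℝ := 1 / √((1 + u ^ 2) * (1 + e * u ^ 2))

theorem continuous_ellIntegrand {e : ℝ} (he : 0 ≤ e) : Continuous (ellIntegrand e) := by
  unfold ellIntegrand
  refine continuous_const.div (by fun_prop) fun u => ?_
  positivity

theorem ellIntegrand_pos {e : ℝ} (he : 0 ≤ e) (u : ℝ) : 0 < ellIntegrand e u := by
  unfold ellIntegrand
  positivity

theorem tendsto_integral_ellIntegrand {α : Type*} {l : Filter α} {T e : α → ℝ} {T₀ e₀ : ℝ}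
    (hT : Tendsto T l (𝓝 T₀)) (he : Tendsto e l (𝓝 e₀)) (h0 : ∀ᶠ x in l, 0 < e x)
    (he₀ : 0 < e₀) :
    Tendsto (fun x => ∫ u in (0 : ℝ)..T x, ellIntegrand (e x) u) l
      (𝓝 (∫ u in (0 : ℝ)..T₀, ellIntegrand e₀ u)) := by
  -- The absolute value keeps the denominator positive for every real parameter, so joint continuity
  -- holds on the whole plane.
  have hc : Continuous fun p : ℝ × ℝ => ∫ u in (0 : ℝ)..p.1, ellIntegrand |p.2| u := by
    apply intervalIntegral.continuous_parametric_intervalIntegral_of_continuous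
      (f := fun p : ℝ × ℝ => ellIntegrand |p.2|) ?_ continuous_fst
    unfold ellIntegrand Function.uncurry
    refine continuous_const.div (by fun_prop) fun p => ?_
    positivity
  have := (hc.tendsto (T₀, e₀)).comp (hT.prodMk_nhds he)
  simp only [abs_of_pos he₀] at this
  refine this.congr' ?_
  filter_upwards [h0] with x hx
  simp [abs_of_pos hx]

/-- An integrable majorant that is uniform in the parameter away from 0, for dominated convergence;
c ≤ 1 gives c(1 + u²) ≤ 1 + eu². -/
theorem ellIntegrand_le {c e : ℝ} (hc : 0 < c) (hc1 : c ≤ 1) (he : c ≤ e) (u : ℝ) :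
    ellIntegrand e u ≤ 1 / √c * (1 + u ^ 2)⁻¹ := by
  have h : √c * (1 + u ^ 2) ≤ √((1 + u ^ 2) * (1 + e * u ^ 2)) := by
    apply Real.le_sqrt_of_sq_le
    rw [mul_pow, Real.sq_sqrt hc.le]
    have : c * (1 + u ^ 2) ≤ 1 + e * u ^ 2 := by nlinarith [sq_nonneg u]
    nlinarith [sq_nonneg u]
  rw [ellIntegrand, ← one_div, one_div_mul_one_div]
  exact one_div_le_one_div_of_le (by positivity) h

theorem integrable_ellIntegrand {e : ℝ} (he : 0 < e) : Integrable (ellIntegrand e) := by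
  have hc : 0 < min e 1 := lt_min he one_pos
  refine (integrable_inv_one_add_sq.const_mul (1 / √(min e 1))).mono'
    (continuous_ellIntegrand he.le).aestronglyMeasurable (.of_forall fun u => ?_)
  rw [Real.norm_of_nonneg (ellIntegrand_pos he.le u).le]
  exact ellIntegrand_le hc (min_le_right _ _) (min_le_left _ _) u

theorem integral_Ioi_ellIntegrand_pos {e : ℝ} (he : 0 < e) :
    0 < ∫ u in Ioi (0 : ℝ), ellIntegrand e u := by
  rw [setIntegral_pos_iff_support_of_nonneg_ae
    (.of_forall fun u => (ellIntegrand_pos he.le u).le) (integrable_ellIntegrand he).integrableOn]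
  have : Function.support (ellIntegrand e) = univ := by
    ext u
    simp [(ellIntegrand_pos he.le u).ne']
  simp [this]

theorem continuousAt_integral_Ioi_ellIntegrand {e : ℝ} (he : 0 < e) :
    ContinuousAt (fun e => ∫ u in Ioi (0 : ℝ), ellIntegrand e u) e := by
  set c := min (e / 2) 1
  have hc : 0 < c := lt_min (by linarith) one_pos
  have hev : ∀ᶠ x in 𝓝 e, c < x := lt_mem_nhds ((min_le_left _ _).trans_lt (by linarith))
  refine continuousAt_of_dominated (bound := fun u => 1 / √c * (1 + u ^ 2)⁻¹) ?_ ?_ ?_ ?_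
  · filter_upwards [hev] with x hx
    exact (continuous_ellIntegrand (hc.trans hx).le).aestronglyMeasurable
  · filter_upwards [hev] with x hx
    refine .of_forall fun u => ?_
    rw [Real.norm_of_nonneg (ellIntegrand_pos (hc.trans hx).le u).le]
    exact ellIntegrand_le hc (min_le_right _ _) hx.le u
  · exact (integrable_inv_one_add_sq.const_mul _).integrableOn
  · refine .of_forall fun u => ?_
    unfold ellIntegrand
    refine continuousAt_const.div (by fun_prop) ?_
    positivity

theorem ellIntegrand_one (u : ℝ) : ellIntegrand 1 u = (1 + u ^ 2)⁻¹ := by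
  rw [ellIntegrand, one_mul, Real.sqrt_mul_self (by positivity), one_div]

theorem integral_ellIntegrand_one (T : ℝ) :
    ∫ u in (0 : ℝ)..T, ellIntegrand 1 u = Real.arctan T := by
  simp [ellIntegrand_one]

theorem integral_Ioi_ellIntegrand_one :
    ∫ u in Ioi (0 : ℝ), ellIntegrand 1 u = Real.pi / 2 := by
  simp [ellIntegrand_one]

theorem integral_inv_sqrt_one_add_sq (T : ℝ) :
    ∫ u in (0 : ℝ)..T, (√(1 + u ^ 2))⁻¹ = Real.arsinh T := by
  rw [intervalIntegral.integral_eq_sub_of_hasDerivAt (fun u _ => Real.hasDerivAt_arsinh u)]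
  · simp
  · refine Continuous.intervalIntegrable (Continuous.inv₀ (by fun_prop) fun u => ?_) _ _
    positivity

theorem integral_ellIntegrand_le {e T : ℝ} (he : 0 ≤ e) (hT : 0 ≤ T) :
    ∫ u in (0 : ℝ)..T, ellIntegrand e u ≤ Real.arsinh T := by
  rw [← integral_inv_sqrt_one_add_sq]
  refine intervalIntegral.integral_mono_on hT
    ((continuous_ellIntegrand he).intervalIntegrable _ _) ?_ fun u _ => ?_
  · refine Continuous.intervalIntegrable (Continuous.inv₀ (by fun_prop) fun u => ?_) _ _
    positivity
  · rw [ellIntegrand, one_div]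
    have : 0 ≤ e * u ^ 2 := by positivity
    gcongr
    nlinarith [sq_nonneg u]

/-- Since 1/√(1 + eu²) ≥ 1 - √e u and u/√(1 + u²) ≤ 1, dropping the second factor costs at most √e
per unit length. -/
theorem le_integral_ellIntegrand {e T : ℝ} (he : 0 ≤ e) (hT : 0 ≤ T) :
    Real.arsinh T - √e * T ≤ ∫ u in (0 : ℝ)..T, ellIntegrand e u := by
  have hi : IntervalIntegrable (fun u : ℝ => (√(1 + u ^ 2))⁻¹) volume 0 T := by
    refine Continuous.intervalIntegrable (Continuous.inv₀ (by fun_prop) fun u => ?_) _ _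
    positivity
  have : ∫ u in (0 : ℝ)..T, ((√(1 + u ^ 2))⁻¹ - √e) = Real.arsinh T - √e * T := by
    rw [intervalIntegral.integral_sub hi (by simp), integral_inv_sqrt_one_add_sq]
    simp [mul_comm]
  rw [← this]
  refine intervalIntegral.integral_mono_on hT (hi.sub (by simp))
    ((continuous_ellIntegrand he).intervalIntegrable _ _) fun u hu => ?_
  have hu0 : 0 ≤ u := hu.1
  rw [ellIntegrand, Real.sqrt_mul (by positivity), one_div, mul_inv]
  set a := (√(1 + u ^ 2))⁻¹ with ha
  have hau : a * u ≤ 1 := by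
    rw [ha, inv_mul_le_one₀ (by positivity)]
    exact Real.le_sqrt_of_sq_le (by linarith)
  have ha0 : 0 ≤ a := by positivity
  have hb : 1 - √e * u ≤ (√(1 + e * u ^ 2))⁻¹ := by
    have h1 : √(1 + e * u ^ 2) ≤ 1 + √e * u := by
      rw [Real.sqrt_le_left (by positivity)]
      nlinarith [Real.sq_sqrt he, mul_nonneg (Real.sqrt_nonneg e) hu0]
    refine le_trans ?_ (inv_anti₀ (by positivity) h1)
    rw [← one_div, le_div_iff₀ (by positivity)]
    nlinarith [sq_nonneg (√e * u)]
  nlinarith [mul_le_mul_of_nonneg_left hb ha0, Real.sqrt_nonneg e,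
    mul_le_mul_of_nonneg_left hau (Real.sqrt_nonneg e)]

/-- The integral is cut at N = 1/√e. Below N the error √e N equals 1; above N the integrand is at
most N u⁻², whose integral is 1. -/
theorem integral_Ioi_ellIntegrand_bounds {e : ℝ} (he : 0 < e) :
    Real.arsinh (√e)⁻¹ - 1 ≤ ∫ u in Ioi (0 : ℝ), ellIntegrand e u ∧
    ∫ u in Ioi (0 : ℝ), ellIntegrand e u ≤ Real.arsinh (√e)⁻¹ + 1 := by
  have hs : 0 < √e := by positivity
  set N := (√e)⁻¹ with hN
  have hN0 : 0 < N := by positivity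
  have hsplit := intervalIntegral.integral_interval_add_Ioi (a := 0) (b := N)
    (integrable_ellIntegrand he).integrableOn (integrable_ellIntegrand he).integrableOn
  have h1 := integral_ellIntegrand_le he.le hN0.le
  have h2 := le_integral_ellIntegrand he.le hN0.le
  have h3 : √e * N = 1 := mul_inv_cancel₀ hs.ne'
  have h4 : 0 ≤ ∫ u in Ioi N, ellIntegrand e u :=
    integral_nonneg fun u => (ellIntegrand_pos he.le u).le
  have h5 : ∫ u in Ioi N, ellIntegrand e u ≤ 1 := by
    have hint : IntegrableOn (fun u : ℝ => N * u ^ (-2 : ℝ)) (Ioi N) :=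
      (integrableOn_Ioi_rpow_of_lt (by norm_num) hN0).const_mul _
    have hval : ∫ u in Ioi N, N * u ^ (-2 : ℝ) = 1 := by
      rw [integral_const_mul, integral_Ioi_rpow_of_lt (by norm_num) hN0]
      norm_num
      rw [Real.rpow_neg_one]
      field_simp
    rw [← hval]
    refine setIntegral_mono_on (integrable_ellIntegrand he).integrableOn hint
      measurableSet_Ioi fun u hu => ?_
    have hu0 : 0 < u := hN0.trans hu
    have : √e * u ^ 2 ≤ √((1 + u ^ 2) * (1 + e * u ^ 2)) := by
      apply Real.le_sqrt_of_sq_le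
      rw [mul_pow, Real.sq_sqrt he.le]
      nlinarith [sq_nonneg u, mul_nonneg he.le (sq_nonneg u)]
    rw [ellIntegrand, Real.rpow_neg hu0.le, Real.rpow_two, hN, ← mul_inv, ← one_div]
    exact one_div_le_one_div_of_le (by positivity) this
  constructor <;> linarith

/-! ### Continuity of θ_d and its limit at K_m -/

theorem theta_eq (d K : ℝ) :
    theta d K = 1 / 2 * ((∫ u in (0 : ℝ)..√((eRoot d K 0 - eRoot d K 2) / nu d K),
      ellIntegrand (eps d K) u) / ∫ u in Ioi (0 : ℝ), ellIntegrand (eps d K) u) :=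
  rfl

theorem tendsto_theta {d L e : ℝ} {l : Filter ℝ} (hd : 0 < d) (hl : ∀ᶠ K in l, Km d < K)
    (hL : Tendsto (fun K => (eRoot d K 0 - eRoot d K 2) / nu d K) l (𝓝 L))
    (he : Tendsto (eps d) l (𝓝 e)) (he0 : 0 < e) :
    Tendsto (theta d) l (𝓝 (1 / 2 * ((∫ u in (0 : ℝ)..√L, ellIntegrand e u) /
      ∫ u in Ioi (0 : ℝ), ellIntegrand e u))) := by
  have h1 := tendsto_integral_ellIntegrand hL.sqrt he
    (hl.mono fun K hK => eps_pos hd hK) he0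
  have h2 := (continuousAt_integral_Ioi_ellIntegrand he0).tendsto.comp he
  exact (h1.div h2 (integral_Ioi_ellIntegrand_pos he0).ne').const_mul _


theorem tendsto_eRoot_sub_div_nu {d K₀ x y z : ℝ} (hd : 0 < d)
    (h0 : Tendsto (fun K => diagRoots d K 0) (𝓝[Ioi (Km d)] K₀) (𝓝 x))
    (h1 : Tendsto (fun K => diagRoots d K 1) (𝓝[Ioi (Km d)] K₀) (𝓝 y))
    (h2 : Tendsto (fun K => diagRoots d K 2) (𝓝[Ioi (Km d)] K₀) (𝓝 z))
    (hx : 0 < d + 2 * x) :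
    Tendsto (fun K => (eRoot d K 0 - eRoot d K 2) / nu d K) (𝓝[Ioi (Km d)] K₀)
      (𝓝 ((K₀ - 2 * x) * (K₀ - 2 * y) * (z - x) / (2 * (d + 2 * x)))) := by
  have hK : Tendsto (fun K : ℝ => K) (𝓝[Ioi (Km d)] K₀) (𝓝 K₀) := nhdsWithin_le_nhds
  refine ((((hK.sub (h0.const_mul 2)).mul (hK.sub (h1.const_mul 2))).mul (h2.sub h0)).div
    (((h0.const_mul 2).const_add d).const_mul 2) (by positivity)).congr' ?_
  filter_upwards [self_mem_nhdsWithin] with K hK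
  exact (eRoot_sub_div_nu hd hK).symm

theorem tendsto_eps {d K₀ x y z : ℝ} (hd : 0 < d)
    (h0 : Tendsto (fun K => diagRoots d K 0) (𝓝[Ioi (Km d)] K₀) (𝓝 x))
    (h1 : Tendsto (fun K => diagRoots d K 1) (𝓝[Ioi (Km d)] K₀) (𝓝 y))
    (h2 : Tendsto (fun K => diagRoots d K 2) (𝓝[Ioi (Km d)] K₀) (𝓝 z))
    (hx : x < z) (hy : 0 < K₀ - 2 * y) :
    Tendsto (eps d) (𝓝[Ioi (Km d)] K₀)
      (𝓝 ((y - x) * (K₀ - 2 * z) / ((z - x) * (K₀ - 2 * y)))) := by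
  have hK : Tendsto (fun K : ℝ => K) (𝓝[Ioi (Km d)] K₀) (𝓝 K₀) := nhdsWithin_le_nhds
  refine (((h1.sub h0).mul (hK.sub (h2.const_mul 2))).div
    ((h2.sub h0).mul (hK.sub (h1.const_mul 2)))
      (mul_pos (sub_pos.2 hx) hy).ne').congr' ?_
  filter_upwards [self_mem_nhdsWithin] with K hK
  exact (eps_eq hd hK).symm

theorem continuousOn_theta {d : ℝ} (hd : 0 < d) : ContinuousOn (theta d) (Ioi (Km d)) := by
  intro K hK
  have h := continuousWithinAt_diagRoots hd hK
  have h0 := diagRoots_lt hd hK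
  have h2 := two_mul_diagRoots_lt hd hK
  have hL := tendsto_eRoot_sub_div_nu hd (h 0) (h 1) (h 2) (neg_half_lt_diagRoots hd hK)
  have he := tendsto_eps hd (h 0) (h 1) (h 2) (h0.1.trans h0.2) (by linarith)
  rw [← eRoot_sub_div_nu hd hK] at hL
  rw [← eps_eq hd hK] at he
  rw [ContinuousWithinAt, theta_eq]
  exact tendsto_theta hd self_mem_nhdsWithin hL he (eps_pos hd hK)

theorem tendsto_theta_Km {d : ℝ} (hd : 0 < d) :
    Tendsto (theta d) (𝓝[>] Km d)
      (𝓝 (1 / Real.pi * Real.arccos ((ell d ^ 2 - 1) / (2 * ell d ^ 2)))) := by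
  have hl := one_lt_ell hd
  have hl3 := (ell_spec hd).2
  have hKm := Km_eq hd
  obtain ⟨h0, h1, h2⟩ := tendsto_diagRoots_Km hd
  set a := ell d
  have ha : 0 < a := by linarith
  have ha2 : 0 < a ^ 2 - 1 := by nlinarith
  have hdx : d + 2 * (-(a - 1 / a) / 2) = (a ^ 2 - 1) ^ 2 / a := by
    have : d = a ^ 3 - a := by linarith
    rw [this]
    field_simp
    ring
  have hpos : 0 < (a ^ 2 - 1) ^ 2 / a := by positivity
  have hinv : 1 / a < 1 := by rw [div_lt_one ha]; exact hl
  have hinv0 : 0 < 1 / a := by positivity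
  have hL := tendsto_eRoot_sub_div_nu hd h0 h1 h2 (by rw [hdx]; exact hpos)
  have he := tendsto_eps hd h0 h1 h2 (by linarith) (by rw [hKm]; linarith)
  -- With f₂ and f₃ both at ℓ, the limit of ε is a nonzero quantity divided by itself.
  have he1 : (a - -(a - 1 / a) / 2) * (Km d - 2 * a) /
      ((a - -(a - 1 / a) / 2) * (Km d - 2 * a)) = 1 := by
    apply div_self
    rw [hKm]
    exact (mul_pos (by linarith) (by linarith)).ne'
  rw [he1] at he
  have ht := tendsto_theta (l := 𝓝[>] Km d) hd self_mem_nhdsWithin hL he one_pos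
  convert ht using 2
  rw [integral_ellIntegrand_one, integral_Ioi_ellIntegrand_one,
    Real.arccos_eq_arctan (by positivity)]
  have hc : (0 : ℝ) < (a ^ 2 - 1) / (2 * a ^ 2) := by positivity
  -- For c = (ℓ² - 1)/(2ℓ²), the tangent of arccos c is √(1 - c²)/c; it has to agree with the
  -- limiting upper bound √L.
  have : √(1 - ((a ^ 2 - 1) / (2 * a ^ 2)) ^ 2) / ((a ^ 2 - 1) / (2 * a ^ 2)) =
      √((Km d - 2 * (-(a - 1 / a) / 2)) * (Km d - 2 * a) * (a - -(a - 1 / a) / 2) /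
        (2 * (d + 2 * (-(a - 1 / a) / 2)))) := by
    conv_lhs => rw [← Real.sqrt_sq hc.le, ← Real.sqrt_div' _ (by positivity), Real.sqrt_sq hc.le]
    congr 1
    rw [hdx, hKm]
    field_simp
    ring
  rw [this]
  field_simp

theorem thetaM_eq {d : ℝ} (hd : 0 < d) :
    thetaM d = 1 / Real.pi * Real.arccos ((ell d ^ 2 - 1) / (2 * ell d ^ 2)) :=
  (tendsto_theta_Km hd).limUnder_eq

/-! ### Asymptotics as K → ∞ -/

section Infinity

variable {d : ℝ}

theorem tendsto_zero_of_mul_sq_le {f : ℝ → ℝ} {C : ℝ} (h : ∀ᶠ K in atTop, K * f K ^ 2 ≤ C) :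
    Tendsto f atTop (𝓝 0) := by
  have h2 : Tendsto (fun K => f K ^ 2) atTop (𝓝 0) := by
    refine squeeze_zero' (.of_forall fun K => sq_nonneg _) ?_
      (tendsto_const_nhds.div_atTop tendsto_id : Tendsto (fun K : ℝ => C / K) atTop (𝓝 0))
    filter_upwards [h, eventually_gt_atTop 0] with K hK hK0
    rw [le_div_iff₀ hK0]
    linarith
  have h3 := h2.sqrt
  simp only [Real.sqrt_sq_eq_abs, Real.sqrt_zero] at h3
  exact (tendsto_zero_iff_abs_tendsto_zero f).2 h3

theorem tendsto_diagRoots_atTop (hd : 0 < d) :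
    Tendsto (fun K => diagRoots d K 0) atTop (𝓝 0) ∧
    Tendsto (fun K => diagRoots d K 1) atTop (𝓝 0) := by
  constructor
  · refine tendsto_zero_of_mul_sq_le (C := d) ?_
    filter_upwards [eventually_gt_atTop (Km d)] with K hK
    have h0 := (diagRoots_sign hd hK).1
    have := (diagRoots_spec hd hK).2 0
    nlinarith [pow_pos (neg_pos.2 h0) 3]
  · refine tendsto_zero_of_mul_sq_le (C := 2 * ell d ^ 3 + 2 * ell d + d) ?_
    filter_upwards [eventually_gt_atTop (Km d)] with K hK
    have h0 := (diagRoots_sign hd hK).2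
    have h1 := (diagRoots_ell hd hK).1
    have := (diagRoots_spec hd hK).2 1
    have := pow_le_pow_left₀ h0.le h1.le 3
    linarith

/-- From Kf² = 2f³ + 2f + d → d each of √K|f₁|, √K|f₂| tends to √d, and the opposite signs make them
add up. -/
theorem tendsto_sqrt_mul_diagRoots_sub (hd : 0 < d) :
    Tendsto (fun K => √K * (diagRoots d K 1 - diagRoots d K 0)) atTop (𝓝 (2 * √d)) := by
  obtain ⟨t0, t1⟩ := tendsto_diagRoots_atTop hd
  have key : ∀ i, Tendsto (fun K => diagRoots d K i) atTop (𝓝 0) →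
      Tendsto (fun K => √K * |diagRoots d K i|) atTop (𝓝 √d) := by
    intro i ti
    have := (((ti.pow 3).const_mul 2).add (ti.const_mul 2)).add_const d
    simp only [ne_eq, OfNat.ofNat_ne_zero, not_false_eq_true, zero_pow, mul_zero, zero_add] at this
    refine this.sqrt.congr' ?_
    filter_upwards [eventually_gt_atTop (Km d)] with K hK
    have hK0 := (Km_pos hd).trans hK
    rw [← Real.sqrt_sq_eq_abs, ← Real.sqrt_mul hK0.le]
    congr 1
    linarith [(diagRoots_spec hd hK).2 i]
  have h := (key 1 t1).add (key 0 t0)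
  rw [← two_mul] at h
  refine h.congr' ?_
  filter_upwards [eventually_gt_atTop (Km d)] with K hK
  obtain ⟨h0, h1⟩ := diagRoots_sign hd hK
  rw [abs_of_neg h0, abs_of_pos h1]
  ring

theorem tendsto_sub_div_atTop (hd : 0 < d) :
    Tendsto (fun K => (K - 2 * diagRoots d K 0) / K) atTop (𝓝 1) ∧
    Tendsto (fun K => (K - 2 * diagRoots d K 1) / K) atTop (𝓝 1) ∧
    Tendsto (fun K => (diagRoots d K 2 - diagRoots d K 0) / K) atTop (𝓝 (1 / 2)) ∧
    Tendsto (fun K => K * (K - 2 * diagRoots d K 2)) atTop (𝓝 4) := by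
  obtain ⟨t0, t1⟩ := tendsto_diagRoots_atTop hd
  have h0 : Tendsto (fun K => diagRoots d K 0 / K) atTop (𝓝 0) := t0.div_atTop tendsto_id
  have h1 : Tendsto (fun K => diagRoots d K 1 / K) atTop (𝓝 0) := t1.div_atTop tendsto_id
  have s0 : Tendsto (fun K => (K - 2 * diagRoots d K 0) / K) atTop (𝓝 1) := by
    have := (h0.const_mul 2).const_sub 1
    rw [mul_zero, sub_zero] at this
    refine this.congr' ?_
    filter_upwards [eventually_gt_atTop 0] with K hK
    field_simp
  have s1 : Tendsto (fun K => (K - 2 * diagRoots d K 1) / K) atTop (𝓝 1) := by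
    have := (h1.const_mul 2).const_sub 1
    rw [mul_zero, sub_zero] at this
    refine this.congr' ?_
    filter_upwards [eventually_gt_atTop 0] with K hK
    field_simp
  refine ⟨s0, s1, ?_, ?_⟩
  · have := ((h0.const_mul 2).const_sub (1 / 2)).sub h1
    rw [mul_zero, sub_zero, sub_zero] at this
    refine this.congr' ?_
    filter_upwards [eventually_gt_atTop (Km d)] with K hK
    have hK0 := (Km_pos hd).trans hK
    have e := (diagRoots_vieta hd hK).1
    field_simp
    linarith
  · have hdK : Tendsto (fun K : ℝ => d / K) atTop (𝓝 0) :=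
      tendsto_const_nhds.div_atTop tendsto_id
    -- The rate of K - 2f₃ is read from the product of the three K - 2fᵢ, which equals 4(K + d).
    have := ((hdK.const_add 1).const_mul 4).div (s0.mul s1) (by norm_num)
    norm_num at this
    refine this.congr' ?_
    filter_upwards [eventually_gt_atTop (Km d)] with K hK
    have hK0 := (Km_pos hd).trans hK
    have hlt := diagRoots_lt hd hK
    have h2 := two_mul_diagRoots_lt hd hK
    have n0 : K - 2 * diagRoots d K 0 ≠ 0 := by linarith
    have n1 : K - 2 * diagRoots d K 1 ≠ 0 := by linarith
    have e := prod_sub_diagRoots hd hK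
    simp only [Pi.div_apply]
    field_simp
    linarith

theorem tendsto_eps_mul (hd : 0 < d) :
    Tendsto (fun K => eps d K * (K ^ 3 * √K)) atTop (𝓝 (16 * √d)) := by
  obtain ⟨s0, s1, s2, s3⟩ := tendsto_sub_div_atTop hd
  have := ((tendsto_sqrt_mul_diagRoots_sub hd).mul s3).div (s2.mul s1) (by norm_num)
  rw [show 2 * √d * 4 / (1 / 2 * 1) = 16 * √d by ring] at this
  refine this.congr' ?_
  filter_upwards [eventually_gt_atTop (Km d)] with K hK
  have hK0 := (Km_pos hd).trans hK
  have hlt := diagRoots_lt hd hK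
  have h2 := two_mul_diagRoots_lt hd hK
  have n1 : K - 2 * diagRoots d K 1 ≠ 0 := by linarith
  have n2 : diagRoots d K 2 - diagRoots d K 0 ≠ 0 := by linarith
  rw [eps_eq hd hK]
  simp only [Pi.div_apply]
  field_simp

theorem tendsto_eRoot_sub_div_nu_div (hd : 0 < d) :
    Tendsto (fun K => (eRoot d K 0 - eRoot d K 2) / nu d K / K ^ 3) atTop
      (𝓝 (1 / (4 * d))) := by
  obtain ⟨s0, s1, s2, s3⟩ := tendsto_sub_div_atTop hd
  obtain ⟨t0, t1⟩ := tendsto_diagRoots_atTop hd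
  have := ((s0.mul s1).mul s2).div (((t0.const_mul 2).const_add d).const_mul 2) (by simp [hd.ne'])
  rw [show 1 * 1 * (1 / 2) / (2 * (d + 2 * 0)) = 1 / (4 * d) by field_simp; ring] at this
  refine this.congr' ?_
  filter_upwards [eventually_gt_atTop (Km d)] with K hK
  have hK0 := (Km_pos hd).trans hK
  have h3 := (neg_half_lt_diagRoots hd hK).ne'
  rw [eRoot_sub_div_nu hd hK]
  simp only [Pi.div_apply]
  field_simp

/-- For x ≥ 1 the argument x + √(1 + x²) of the logarithm lies between x and 3x. -/
theorem arsinh_sub_log_isBigO {α : Type*} {l : Filter α} {f : α → ℝ} (hf : Tendsto f l atTop) :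
    (fun x => Real.arsinh (f x) - Real.log (f x)) =O[l] (fun _ => (1 : ℝ)) := by
  refine IsBigO.of_bound (Real.log 3) ?_
  filter_upwards [hf.eventually_ge_atTop 1] with x hx
  have h0 : 0 < f x := by linarith
  have h1 : Real.log (f x) ≤ Real.arsinh (f x) := by
    rw [Real.arsinh]
    exact Real.log_le_log h0 (by linarith [Real.sqrt_nonneg (1 + f x ^ 2)])
  have h2 : Real.arsinh (f x) ≤ Real.log 3 + Real.log (f x) := by
    rw [Real.arsinh, ← Real.log_mul (by norm_num) h0.ne']
    refine Real.log_le_log (by positivity) ?_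
    have : √(1 + f x ^ 2) ≤ 2 * f x := by
      rw [Real.sqrt_le_left (by positivity)]
      nlinarith
    linarith
  rw [Real.norm_of_nonneg (by linarith)]
  simp
  linarith

theorem log_sub_isBigO {α : Type*} {l : Filter α} {f g : α → ℝ} {c : ℝ} (hc : 0 < c)
    (hf : ∀ᶠ x in l, 0 < f x) (hg : ∀ᶠ x in l, 0 < g x)
    (h : Tendsto (fun x => f x / g x) l (𝓝 c)) :
    (fun x => Real.log (f x) - Real.log (g x)) =O[l] (fun _ => (1 : ℝ)) := by
  refine ((h.log hc.ne').congr' ?_).isBigO_one ℝ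
  filter_upwards [hf, hg] with x h1 h2
  exact Real.log_div h1.ne' h2.ne'

theorem tendsto_div_log_of_isBigO {f : ℝ → ℝ} {c : ℝ}
    (h : (fun K => f K - c * Real.log K) =O[atTop] (fun _ => (1 : ℝ))) :
    Tendsto (fun K => f K / Real.log K) atTop (𝓝 c) := by
  have h1 : (fun _ : ℝ => (1 : ℝ)) =o[atTop] Real.log := by
    rw [isLittleO_one_left_iff ℝ]
    exact tendsto_norm_atTop_atTop.comp Real.tendsto_log_atTop
  have h2 := (h.trans_isLittleO h1).tendsto_div_nhds_zero.add_const c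
  rw [zero_add] at h2
  refine h2.congr' ?_
  filter_upwards [eventually_gt_atTop 1] with K hK
  have := Real.log_pos hK
  field_simp
  ring

theorem tendsto_cube_mul_sqrt : Tendsto (fun K : ℝ => K ^ 3 * √K) atTop atTop :=
  (tendsto_pow_atTop (by norm_num)).atTop_mul_atTop₀ Real.tendsto_sqrt_atTop

theorem tendsto_inv_sqrt_eps (hd : 0 < d) : Tendsto (fun K => (√(eps d K))⁻¹) atTop atTop := by
  have h := ((tendsto_eps_mul hd).inv₀ (by positivity)).pos_mul_atTop (by positivity)
    tendsto_cube_mul_sqrt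
  refine (Real.tendsto_sqrt_atTop.comp h).congr' ?_
  filter_upwards [eventually_gt_atTop (Km d)] with K hK
  have hK0 := (Km_pos hd).trans hK
  have := eps_pos hd hK
  rw [Function.comp_apply, ← Real.sqrt_inv]
  congr 1
  field_simp

theorem tendsto_sqrt_eRoot_sub_div_nu (hd : 0 < d) :
    Tendsto (fun K => √((eRoot d K 0 - eRoot d K 2) / nu d K)) atTop atTop := by
  have h := (tendsto_eRoot_sub_div_nu_div hd).pos_mul_atTop (by positivity)
    (tendsto_pow_atTop (α := ℝ) (n := 3) (by norm_num))
  refine Real.tendsto_sqrt_atTop.comp (h.congr' ?_)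
  filter_upwards [eventually_gt_atTop 0] with K hK
  field_simp

theorem log_eps_isBigO (hd : 0 < d) :
    (fun K => Real.log (eps d K) - -(7 / 2) * Real.log K) =O[atTop] (fun _ => (1 : ℝ)) := by
  refine (log_sub_isBigO (f := eps d) (g := fun K => (K ^ 3 * √K)⁻¹) (c := 16 * √d)
    (by positivity) ?_ ?_ ?_).congr' ?_ .rfl
  · filter_upwards [eventually_gt_atTop (Km d)] with K hK using eps_pos hd hK
  · filter_upwards [eventually_gt_atTop 0] with K hK
    positivity
  · simpa only [div_inv_eq_mul] using tendsto_eps_mul hd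
  · filter_upwards [eventually_gt_atTop 0] with K hK
    rw [Real.log_inv, Real.log_mul (by positivity) (by positivity), Real.log_pow,
      Real.log_sqrt hK.le]
    push_cast
    ring

theorem log_eRoot_sub_div_nu_isBigO (hd : 0 < d) :
    (fun K => Real.log ((eRoot d K 0 - eRoot d K 2) / nu d K) - 3 * Real.log K)
      =O[atTop] (fun _ => (1 : ℝ)) := by
  refine (log_sub_isBigO (g := fun K => K ^ 3) (by positivity) ?_ ?_
    (tendsto_eRoot_sub_div_nu_div hd)).congr' ?_ .rfl
  · filter_upwards [eventually_gt_atTop (Km d)] with K hK using eRoot_sub_div_nu_pos hd hK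
  · filter_upwards [eventually_gt_atTop 0] with K hK
    positivity
  · filter_upwards with K
    rw [Real.log_pow]
    push_cast
    ring

theorem integral_Ioi_ellIntegrand_eps_isBigO (hd : 0 < d) :
    (fun K => (∫ u in Ioi (0 : ℝ), ellIntegrand (eps d K) u) - 7 / 4 * Real.log K)
      =O[atTop] (fun _ => (1 : ℝ)) := by
  have h1 : (fun K => (∫ u in Ioi (0 : ℝ), ellIntegrand (eps d K) u) -
      Real.arsinh (√(eps d K))⁻¹) =O[atTop] (fun _ => (1 : ℝ)) := by
    refine IsBigO.of_bound 1 ?_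
    filter_upwards [eventually_gt_atTop (Km d)] with K hK
    obtain ⟨h1, h2⟩ := integral_Ioi_ellIntegrand_bounds (eps_pos hd hK)
    rw [Real.norm_eq_abs, norm_one, mul_one, abs_le]
    constructor <;> linarith
  have h2 := arsinh_sub_log_isBigO (tendsto_inv_sqrt_eps hd)
  have h3 := (log_eps_isBigO hd).const_mul_left (-(1 / 2))
  refine ((h1.add h2).add h3).congr' ?_ .rfl
  filter_upwards [eventually_gt_atTop (Km d)] with K hK
  rw [Real.log_inv, Real.log_sqrt (eps_pos hd hK).le]
  ring

theorem integral_ellIntegrand_eps_isBigO (hd : 0 < d) :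
    (fun K => (∫ u in (0 : ℝ)..√((eRoot d K 0 - eRoot d K 2) / nu d K),
      ellIntegrand (eps d K) u) - 3 / 2 * Real.log K) =O[atTop] (fun _ => (1 : ℝ)) := by
  -- Here εL is of order K^{-1/2}, so the error √ε √L of `le_integral_ellIntegrand` is eventually at
  -- most 1.
  have hz : Tendsto (fun K => √(eps d K) * √((eRoot d K 0 - eRoot d K 2) / nu d K)) atTop
      (𝓝 0) := by
    have h := (((tendsto_eps_mul hd).mul (tendsto_eRoot_sub_div_nu_div hd)).div_atTop
      Real.tendsto_sqrt_atTop).sqrt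
    rw [Real.sqrt_zero] at h
    refine h.congr' ?_
    filter_upwards [eventually_gt_atTop (Km d)] with K hK
    have hK0 := (Km_pos hd).trans hK
    rw [← Real.sqrt_mul (eps_pos hd hK).le]
    congr 1
    field_simp
  have h1 : (fun K => (∫ u in (0 : ℝ)..√((eRoot d K 0 - eRoot d K 2) / nu d K),
      ellIntegrand (eps d K) u) - Real.arsinh √((eRoot d K 0 - eRoot d K 2) / nu d K))
      =O[atTop] (fun _ => (1 : ℝ)) := by
    refine IsBigO.of_bound 1 ?_
    filter_upwards [eventually_gt_atTop (Km d), hz.eventually_le_const one_pos] with K hK hle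
    have h1 := integral_ellIntegrand_le (eps_pos hd hK).le
      (Real.sqrt_nonneg ((eRoot d K 0 - eRoot d K 2) / nu d K))
    have h2 := le_integral_ellIntegrand (eps_pos hd hK).le
      (Real.sqrt_nonneg ((eRoot d K 0 - eRoot d K 2) / nu d K))
    rw [Real.norm_eq_abs, norm_one, mul_one, abs_le]
    constructor <;> linarith
  have h2 := arsinh_sub_log_isBigO (tendsto_sqrt_eRoot_sub_div_nu hd)
  have h3 := (log_eRoot_sub_div_nu_isBigO hd).const_mul_left (1 / 2)
  refine ((h1.add h2).add h3).congr' ?_ .rfl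
  filter_upwards [eventually_gt_atTop (Km d)] with K hK
  rw [Real.log_sqrt (eRoot_sub_div_nu_pos hd hK).le]
  ring

theorem tendsto_theta_atTop (hd : 0 < d) : Tendsto (theta d) atTop (𝓝 (3 / 7)) := by
  have h := ((tendsto_div_log_of_isBigO (integral_ellIntegrand_eps_isBigO hd)).div
    (tendsto_div_log_of_isBigO (integral_Ioi_ellIntegrand_eps_isBigO hd))
    (by norm_num)).const_mul (1 / 2)
  rw [show (1 / 2 * (3 / 2 / (7 / 4)) : ℝ) = 3 / 7 by norm_num] at h
  refine h.congr' ?_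
  filter_upwards [eventually_gt_atTop 1] with K hK
  have := (Real.log_pos hK).ne'
  rw [theta_eq, Pi.div_apply, div_div_div_cancel_right₀ this]

end Infinity

/-! ### The image of θ_d -/

theorem Ioo_subset_image_theta {d : ℝ} (hd : 0 < d) :
    Ioo (min (3 / 7) (thetaM d)) (max (3 / 7) (thetaM d)) ⊆ theta d '' Ioi (Km d) := by
  have hm := tendsto_theta_Km hd
  rw [← thetaM_eq hd] at hm
  have ht := tendsto_theta_atTop hd
  intro c hc
  have hconn : IsPreconnected (Ioi (Km d)) := isPreconnected_Ioi
  have hsub : ∀ a ∈ Ioi (Km d), ∀ b ∈ Ioi (Km d), c ∈ Icc (theta d a) (theta d b) →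
      c ∈ theta d '' Ioi (Km d) := fun a ha b hb h =>
    hconn.intermediate_value ha hb (continuousOn_theta hd) h
  rcases le_total (3 / 7) (thetaM d) with h | h
  · rw [min_eq_left h, max_eq_right h] at hc
    obtain ⟨a, ha, ha'⟩ := ((ht.eventually_lt_const hc.1).and (eventually_gt_atTop (Km d))).exists
    obtain ⟨b, hb, hb'⟩ := ((hm.eventually_const_lt hc.2).and self_mem_nhdsWithin).exists
    exact hsub a ha' b hb' ⟨ha.le, hb.le⟩
  · rw [min_eq_right h, max_eq_left h] at hc
    obtain ⟨a, ha, ha'⟩ := ((ht.eventually_const_lt hc.2).and (eventually_gt_atTop (Km d))).exists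
    obtain ⟨b, hb, hb'⟩ := ((hm.eventually_lt_const hc.1).and self_mem_nhdsWithin).exists
    exact hsub b hb' a ha' ⟨hb.le, ha.le⟩

/-! ### The function d ↦ ℓ(d) -/

/-- The map t ↦ t³ - t increases on [1, ∞[, so comparing a with ℓ amounts to comparing a³ - a with
d. Monotonicity, continuity and the limits of ℓ all follow from this. -/
theorem lt_ell_iff {d a : ℝ} (hd : 0 < d) (ha : 1 ≤ a) :
    (a < ell d ↔ a ^ 3 - a < d) ∧ (ell d < a ↔ d < a ^ 3 - a) := by
  have hl := one_lt_ell hd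
  have h0 := (ell_spec hd).2
  have e : d - (a ^ 3 - a) = (ell d ^ 2 + ell d * a + a ^ 2 - 1) * (ell d - a) := by
    linear_combination -h0
  have hp : 0 < ell d ^ 2 + ell d * a + a ^ 2 - 1 := by nlinarith
  constructor
  · rw [← sub_pos, ← sub_pos (b := a ^ 3 - a), e, mul_pos_iff_of_pos_left hp]
  · rw [← sub_neg, ← sub_neg (b := a ^ 3 - a), e, ← neg_pos (a := _ * _), ← mul_neg,
      mul_pos_iff_of_pos_left hp, neg_pos]

theorem ell_eq_of_cubic {d a : ℝ} (hd : 0 < d) (ha : 0 < a) (h : a ^ 3 - a - d = 0) :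
    ell d = a :=
  (existsUnique_ell hd).unique (ell_spec hd) ⟨ha, h⟩

theorem strictMonoOn_ell : StrictMonoOn ell (Ioi 0) := by
  intro d hd d' hd' h
  refine (lt_ell_iff hd' (one_lt_ell hd).le).1.2 ?_
  linarith [(ell_spec hd).2]

theorem continuousOn_ell : ContinuousOn ell (Ioi 0) := by
  intro d hd
  refine tendsto_order.2 ⟨fun a ha => ?_, fun a ha => ?_⟩
  · by_cases h1 : 1 ≤ a
    · filter_upwards [self_mem_nhdsWithin,
        nhdsWithin_le_nhds (lt_mem_nhds ((lt_ell_iff hd h1).1.1 ha))] with x hx hp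
      exact (lt_ell_iff hx h1).1.2 hp
    · filter_upwards [self_mem_nhdsWithin] with x hx
      exact (not_le.1 h1).trans (one_lt_ell hx)
  · have h1 : 1 ≤ a := ((one_lt_ell hd).trans ha).le
    filter_upwards [self_mem_nhdsWithin,
      nhdsWithin_le_nhds (gt_mem_nhds ((lt_ell_iff hd h1).2.1 ha))] with x hx hp
    exact (lt_ell_iff hx h1).2.2 hp

theorem tendsto_ell_zero : Tendsto ell (𝓝[>] 0) (𝓝 1) := by
  refine tendsto_order.2 ⟨fun a ha => ?_, fun a ha => ?_⟩
  · filter_upwards [self_mem_nhdsWithin] with x hx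
    exact ha.trans (one_lt_ell hx)
  · have : 0 < a ^ 3 - a := by nlinarith [mul_pos (by linarith : 0 < a) (sub_pos.2 ha)]
    filter_upwards [self_mem_nhdsWithin, nhdsWithin_le_nhds (gt_mem_nhds this)] with x hx hp
    exact (lt_ell_iff hx ha.le).2.2 hp

theorem tendsto_ell_atTop : Tendsto ell atTop atTop := by
  refine tendsto_atTop.2 fun b => ?_
  filter_upwards [eventually_gt_atTop 0, eventually_gt_atTop ((max b 1) ^ 3 - max b 1)] with x hx hp
  exact (le_max_left b 1).trans ((lt_ell_iff hx (le_max_right b 1)).1.2 hp).le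

/-! ### The function θ_m -/

theorem thetaM_eq_arccos {d : ℝ} (hd : 0 < d) :
    thetaM d = 1 / Real.pi * Real.arccos ((1 - (ell d ^ 2)⁻¹) / 2) := by
  have hl := one_lt_ell hd
  rw [thetaM_eq hd]
  congr 2
  field_simp

theorem thetaM_eq_arccos_double {d : ℝ} (hd : 0 < d) :
    thetaM d = 1 / (2 * Real.pi) *
      Real.arccos ((1 - 2 * ell d ^ 2 - ell d ^ 4) / (2 * ell d ^ 4)) := by
  have hl := one_lt_ell hd
  have hc : 0 ≤ (ell d ^ 2 - 1) / (2 * ell d ^ 2) := by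
    have : 0 ≤ ell d ^ 2 - 1 := by nlinarith
    positivity
  have hc1 : (ell d ^ 2 - 1) / (2 * ell d ^ 2) ≤ 1 := by
    rw [div_le_one (by positivity)]
    nlinarith
  have h : (1 - 2 * ell d ^ 2 - ell d ^ 4) / (2 * ell d ^ 4) =
      Real.cos (2 * Real.arccos ((ell d ^ 2 - 1) / (2 * ell d ^ 2))) := by
    rw [Real.cos_two_mul, Real.cos_arccos (by linarith) hc1]
    field_simp
    ring
  -- The cosine is nonnegative, so the doubled angle stays in [0, π], where `arccos` inverts `cos`.
  have := Real.arccos_le_pi_div_two.2 hc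
  rw [h, Real.arccos_cos (by linarith [Real.arccos_nonneg ((ell d ^ 2 - 1) / (2 * ell d ^ 2))])
    (by linarith), thetaM_eq hd]
  field_simp

theorem strictAntiOn_thetaM : StrictAntiOn thetaM (Ioi 0) := by
  intro d hd d' hd' h
  have hl := one_lt_ell hd
  have hl' := one_lt_ell hd'
  have hlt := strictMonoOn_ell hd hd' h
  rw [thetaM_eq_arccos hd, thetaM_eq_arccos hd']
  have h1 : (ell d' ^ 2)⁻¹ < (ell d ^ 2)⁻¹ := by gcongr
  have h2 : (ell d ^ 2)⁻¹ < 1 := inv_lt_one_of_one_lt₀ (by nlinarith)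
  have h3 : 0 < (ell d' ^ 2)⁻¹ := by positivity
  refine mul_lt_mul_of_pos_left ?_ (one_div_pos.2 Real.pi_pos)
  exact Real.strictAntiOn_arccos ⟨by linarith, by linarith⟩ ⟨by linarith, by linarith⟩ (by linarith)

theorem continuousOn_thetaM : ContinuousOn thetaM (Ioi 0) := by
  refine ContinuousOn.congr ?_ fun d hd => thetaM_eq_arccos hd
  refine continuousOn_const.mul (Real.continuous_arccos.comp_continuousOn ?_)
  refine (continuousOn_const.sub ((continuousOn_ell.pow 2).inv₀ fun d hd => ?_)).div_const 2
  exact pow_ne_zero 2 (zero_lt_one.trans (one_lt_ell hd)).ne'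

theorem tendsto_thetaM_zero : Tendsto thetaM (𝓝[>] 0) (𝓝 (1 / 2)) := by
  have h := ((Real.continuous_arccos.tendsto _).comp
    ((((tendsto_ell_zero.pow 2).inv₀ (by norm_num)).const_sub 1).div_const 2)).const_mul
      (1 / Real.pi)
  norm_num at h
  rw [show Real.pi⁻¹ * (Real.pi / 2) = 1 / 2 by field_simp] at h
  refine h.congr' ?_
  filter_upwards [self_mem_nhdsWithin] with d hd
  simp [thetaM_eq_arccos hd]

theorem arccos_one_half : Real.arccos (1 / 2) = Real.pi / 3 := by
  rw [← Real.cos_pi_div_three, Real.arccos_cos (by positivity) (by linarith [Real.pi_pos])]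

theorem tendsto_thetaM_atTop : Tendsto thetaM atTop (𝓝 (1 / 3)) := by
  have h0 : Tendsto (fun d => (ell d ^ 2)⁻¹) atTop (𝓝 0) :=
    tendsto_inv_atTop_zero.comp ((tendsto_pow_atTop two_ne_zero).comp tendsto_ell_atTop)
  have h := ((Real.continuous_arccos.tendsto _).comp
    ((h0.const_sub 1).div_const 2)).const_mul (1 / Real.pi)
  rw [sub_zero, arccos_one_half, show 1 / Real.pi * (Real.pi / 3) = 1 / 3 by field_simp] at h
  refine h.congr' ?_
  filter_upwards [eventually_gt_atTop 0] with d hd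
  rw [thetaM_eq_arccos hd, Function.comp_apply]

/-! ### sin(π/14) and the critical value d₀ -/

theorem sin_pi_div_fourteen_pos : 0 < Real.sin (Real.pi / 14) :=
  Real.sin_pos_of_pos_of_lt_pi (by positivity) (by linarith [Real.pi_pos])

/-- `sin (π / 14)` is a root of `8 s³ - 4 s² - 4 s + 1`. -/
theorem sin_pi_div_fourteen_cubic :
    8 * Real.sin (Real.pi / 14) ^ 3 - 4 * Real.sin (Real.pi / 14) ^ 2
      - 4 * Real.sin (Real.pi / 14) + 1 = 0 := by
  set x := Real.pi / 14 with hx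
  -- Since 3x + 4x = π/2, sin 3x = cos 4x. This is a quartic in sin x with the extraneous factor sin
  -- x + 1.
  have h : Real.sin (3 * x) = Real.cos (2 * (2 * x)) := by
    rw [← Real.cos_pi_div_two_sub]
    congr 1
    rw [hx]; ring
  rw [Real.sin_three_mul, Real.cos_two_mul, Real.cos_two_mul, Real.cos_sq'] at h
  have hs : 0 < Real.sin x := sin_pi_div_fourteen_pos
  exact mul_left_cancel₀ (by linarith : Real.sin x + 1 ≠ 0) (by linear_combination -h)

/-- The crude bound s < 0.23 makes the cofactor of s - a positive for 0 < a < 0.23, so the sign of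
the cubic at a decides on which side of a the number s lies. -/
theorem sin_pi_div_fourteen_bounds :
    0.2225 < Real.sin (Real.pi / 14) ∧ Real.sin (Real.pi / 14) < 0.22253 := by
  have h0 := sin_pi_div_fourteen_pos
  have hc := sin_pi_div_fourteen_cubic
  have h1 : Real.sin (Real.pi / 14) < 0.23 := by
    have := Real.sin_lt (by positivity : 0 < Real.pi / 14)
    linarith [Real.pi_lt_d2]
  set s := Real.sin (Real.pi / 14)
  have key : ∀ a : ℝ, 8 * a ^ 3 - 4 * a ^ 2 - 4 * a + 1 =
      (s - a) * (4 + 4 * (a + s) - 8 * (a ^ 2 + a * s + s ^ 2)) := fun a => by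
    linear_combination hc
  have hpos : ∀ a : ℝ, 0 < a → a < 0.23 →
      0 < 4 + 4 * (a + s) - 8 * (a ^ 2 + a * s + s ^ 2) := fun a ha ha' => by
    nlinarith
  constructor
  · rw [← sub_pos, ← mul_pos_iff_of_pos_right (hpos 0.2225 (by norm_num) (by norm_num)), ← key]
    norm_num
  · rw [← sub_neg, ← neg_pos,
      ← mul_pos_iff_of_pos_right (hpos 0.22253 (by norm_num) (by norm_num)), neg_mul, ← key]
    norm_num

/-- With ℓ₀ = (1 - 2s)^{-1/2} one has ℓ₀² - 1 = 2s/(1 - 2s), so d₀ = ℓ₀³ - ℓ₀ is the equation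
defining ℓ(d₀). -/
theorem d0_eq : d0 = (1 / √(1 - 2 * Real.sin (Real.pi / 14))) ^ 3 -
    1 / √(1 - 2 * Real.sin (Real.pi / 14)) := by
  obtain ⟨h1, h2⟩ := sin_pi_div_fourteen_bounds
  rw [d0]
  set s := Real.sin (Real.pi / 14)
  have hp : 0 < 1 - 2 * s := by linarith
  have hr : (1 - 2 * s) ^ (3 / 2 : ℝ) = √(1 - 2 * s) ^ 3 := by
    rw [Real.sqrt_eq_rpow, ← Real.rpow_natCast, ← Real.rpow_mul hp.le]
    norm_num
  have hq : 0 < √(1 - 2 * s) := by positivity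
  have hsq := Real.sq_sqrt hp.le
  rw [hr]
  field_simp
  linarith

theorem d0_pos : 0 < d0 := by
  obtain ⟨h1, h2⟩ := sin_pi_div_fourteen_bounds
  have : 0 < 1 - 2 * Real.sin (Real.pi / 14) := by linarith
  have := sin_pi_div_fourteen_pos
  rw [d0]
  positivity

theorem ell_d0 : ell d0 = 1 / √(1 - 2 * Real.sin (Real.pi / 14)) := by
  obtain ⟨h1, h2⟩ := sin_pi_div_fourteen_bounds
  have : 0 < 1 - 2 * Real.sin (Real.pi / 14) := by linarith
  exact ell_eq_of_cubic d0_pos (by positivity) (by rw [d0_eq]; ring)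

theorem thetaM_d0 : thetaM d0 = 3 / 7 := by
  obtain ⟨h1, h2⟩ := sin_pi_div_fourteen_bounds
  have hp : 0 ≤ 1 - 2 * Real.sin (Real.pi / 14) := by linarith
  have h : (1 - (ell d0 ^ 2)⁻¹) / 2 = Real.cos (3 * Real.pi / 7) := by
    rw [ell_d0, one_div, inv_pow, inv_inv, Real.sq_sqrt hp, ← Real.sin_pi_div_two_sub,
      show Real.pi / 2 - 3 * Real.pi / 7 = Real.pi / 14 by ring]
    ring
  rw [thetaM_eq_arccos d0_pos, h, Real.arccos_cos (by positivity) (by linarith [Real.pi_pos])]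
  field_simp

theorem abs_d0_sub_lt : |d0 - 1.076| < 1 / 1000 := by
  obtain ⟨h1, h2⟩ := sin_pi_div_fourteen_bounds
  have hp : 0 < 1 - 2 * Real.sin (Real.pi / 14) := by linarith
  have l1 : 1.3423 < 1 / √(1 - 2 * Real.sin (Real.pi / 14)) := by
    rw [lt_div_iff₀ (by positivity), ← lt_div_iff₀' (by norm_num),
      Real.sqrt_lt' (by norm_num)]
    norm_num
    linarith
  have l2 : 1 / √(1 - 2 * Real.sin (Real.pi / 14)) < 1.3424 := by
    rw [div_lt_iff₀ (by positivity), ← div_lt_iff₀' (by norm_num),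
      Real.lt_sqrt (by norm_num)]
    norm_num
    linarith
  rw [d0_eq, abs_lt]
  set a := 1 / √(1 - 2 * Real.sin (Real.pi / 14))
  have p1 := pow_lt_pow_left₀ l1 (by norm_num) (three_ne_zero)
  have p2 := pow_lt_pow_left₀ l2 (by linarith) (three_ne_zero)
  norm_num at p1 p2 l1 l2 ⊢
  constructor <;> linarith

theorem proposition4 :
    (∀ d : ℝ, 0 < d →
      Tendsto (theta d) (𝓝[>] Km d) (𝓝 (thetaM d)) ∧
      thetaM d = 1 / (2 * Real.pi) *
        Real.arccos ((1 - 2 * ell d ^ 2 - ell d ^ 4) / (2 * ell d ^ 4)) ∧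
      thetaM d = 1 / Real.pi * Real.arccos ((ell d ^ 2 - 1) / (2 * ell d ^ 2))) ∧
    ContinuousOn thetaM (Ioi 0) ∧
    StrictAntiOn thetaM (Ioi 0) ∧
    Tendsto thetaM (𝓝[>] 0) (𝓝 (1 / 2)) ∧
    Tendsto thetaM atTop (𝓝 (1 / 3)) ∧
    (∀ d : ℝ, 0 < d →
      Ioo (min (3 / 7) (thetaM d)) (max (3 / 7) (thetaM d)) ⊆ theta d '' Ioi (Km d)) ∧
    (∀ d : ℝ, 0 < d →
      (thetaM d = 3 / 7 ↔ d = d0) ∧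
      (thetaM d < 3 / 7 ↔ d0 < d) ∧
      (3 / 7 < thetaM d ↔ d < d0)) ∧
    |d0 - 1.076| < 1 / 1000 ∧
    ell d0 = 1 / √(1 - 2 * Real.sin (Real.pi / 14)) := by
  refine ⟨fun d hd => ⟨?_, thetaM_eq_arccos_double hd, thetaM_eq hd⟩, continuousOn_thetaM,
    strictAntiOn_thetaM, tendsto_thetaM_zero, tendsto_thetaM_atTop,
    fun d hd => Ioo_subset_image_theta hd, fun d hd => ?_, abs_d0_sub_lt, ell_d0⟩
  · rw [thetaM_eq hd]
    exact tendsto_theta_Km hd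
  -- Once 3/7 is written as θ_m(d₀), strict monotonicity gives all three equivalences.
  · rw [← thetaM_d0]
    exact ⟨strictAntiOn_thetaM.injOn.eq_iff hd d0_pos, strictAntiOn_thetaM.lt_iff_gt hd d0_pos,
      strictAntiOn_thetaM.lt_iff_gt d0_pos hd⟩
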